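/- Let $\mathcal G$ be a connected undirected graph on finitely many vertices $v_1,\dots,v_N$ with symmetric adjacency matrix $A=[a_{ij}]$, where $a_{ij}>0$ if $v_i$ and $v_j$ are adjacent and $a_{ij}=0$ otherwise (in particular $a_{ii}=0$; the unweighted graph is the case $a_{ij}\in\{0,1\}$). Let $L=\mathrm{diag}\bigl(\sum_j a_{1j},\dots,\sum_j a_{Nj}\bigr)-A$ be its Laplacian, and let $e_i$ be the $i$-th standard basis vector of $\mathbb R^N$. For vertices $v_a$ (attack), $v_\tau$ (target) and $v_m$ (monitor), consider $$\dot x(t)=-Lx(t)+e_a\,a(t),\qquad y_\tau(t)=e_\tau^\top x(t),\qquad y_m(t)=e_m^\top x(t),\qquad t\ge 0,$$ and the two strictly proper SISO systems $\Sigma_\tau=(-L,e_a,e_\tau^\top,0)$ and $\Sigma_m=(-L,e_a,e_m^\top,0)$ with the common attack input $a$. A system $(F,B,C,0)$ of order $N$ has relative degree $r$, $1\le r\le N$, if $CF^kB=0$ for $0\le k<r-1$ and $CF^{r-1}B\ne 0$. A number $\lambda\in\mathbb C$ is a finite invariant zero of it if there are $\bar x\in\mathbb C^N$, $\bar x\neq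 0$, and $g\in\mathbb C$ with $(\lambda I-F)\bar x-Bg=0$ and $C\bar x=0$; it is unstable if $\operatorname{Re}\lambda\ge 0$. Write $\|y\|^2=\int_0^\infty |y(t)|^2\,dt\in[0,\infty]$, and let $\mathcal L_{2e}$ be the set of measurable functions on $(0,\infty)$ that are square integrable on $(0,T)$ for every finite $T>0$. The worst-case impact of a stealthy attack is $$\sup\bigl\{\|y_\tau\|^2 : a\in\mathcal L_{2e},\ x(0)=0,\ \|y_m\|^2\le 1\bigr\}\in[0,\infty],$$ and, as the output-to-output gain $J_\tau(v_a,v_m)$, it is rewritten as $$\inf\bigl\{\gamma>0 : \|y_\tau\|^2\le\gamma\|y_m\|^2\ \text{ for all } a\in\mathcal L_{2e} \text{ with } x(0)=0\bigr\}\in[0,\infty],\qquad \inf\emptyset=\infty .$$ **Theorem.** Suppose that $\Sigma_\tau$ and $\Sigma_m$ have relative degrees $r_{\tau a}$ and $r_{ma}$, respectively, and that $\Sigma_m$ has no finite unstable invariant zero. Then the worst-case impact of a stealthy attack is finite if and only if $r_{ma}\le r_{\tau a}$, and likewise the output-to-output gain $J_\tau(v_a,v_m)$ is finite if and only if $r_{ma}\le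 r_{\tau a}$. -/

import Mathlib

open scoped ENNReal

noncomputable section

namespace NetAttack

/-- `W` is the adjacency matrix of an undirected graph with positive edge weights and with edge
set given by `G`.  The unweighted network is the case `W = G.adjMatrix ℝ`. -/
structure IsWeightedAdjacency {V : Type*} (G : SimpleGraph V) (W : Matrix V V ℝ) : Prop where
  symm : W.IsSymm
  pos : ∀ i j, G.Adj i j → 0 < W i j
  zero : ∀ i j, ¬ G.Adj i j → W i j = 0

/-- The Laplacian `L = D - W`, where `D` is the diagonal matrix of the degrees `∑ j, W i j`. -/
def laplacian {V : Type*} [Fintype V] [DecidableEq V] (W : Matrix V V ℝ) : Matrix V V ℝ :=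
  Matrix.diagonal (fun i => ∑ j, W i j) - W

/-- A strictly proper SISO system `(A, B, C, 0)`, that is `x' = A x + B u`, `y = C x`. -/
structure SISO (V : Type*) where
  /-- the state matrix -/
  A : Matrix V V ℝ
  /-- the input column -/
  B : V → ℝ
  /-- the output row -/
  C : V → ℝ

/-- The system `(-L, e_a, e_vᵀ, 0)`: input at the vertex `a`, output at the vertex `v`. -/
def vertexSystem {V : Type*} [DecidableEq V] (L : Matrix V V ℝ) (a v : V) : SISO V where
  A := -L
  B := Pi.single a 1
  C := Pi.single v 1

/-- `s` is a finite invariant zero of the system: the Rosenbrock matrix at `s` annihilates a vector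
`(x, g)` with `x ≠ 0`. -/
def SISO.IsInvariantZero {V : Type*} [Fintype V] [DecidableEq V] (S : SISO V) (s : ℂ) : Prop :=
  ∃ (x : V → ℂ) (g : ℂ), x ≠ 0 ∧
    (s • (1 : Matrix V V ℂ) - S.A.map Complex.ofReal).mulVec x - g • (fun i => (S.B i : ℂ)) = 0 ∧
    (fun i => (S.C i : ℂ)) ⬝ᵥ x = 0

/-- No finite invariant zero lies in the closed right half-plane. -/
def SISO.NoUnstableInvariantZero {V : Type*} [Fintype V] [DecidableEq V] (S : SISO V) : Prop :=
  ∀ s : ℂ, 0 ≤ s.re → ¬ S.IsInvariantZero s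

/-- The system has relative degree `r`: `1 ≤ r ≤ n`, `C A ^ k B = 0` for `0 ≤ k < r - 1`, and
`C A ^ (r - 1) B ≠ 0`. -/
def SISO.HasRelativeDegree {V : Type*} [Fintype V] [DecidableEq V] (S : SISO V) (r : ℕ) : Prop :=
  1 ≤ r ∧ r ≤ Fintype.card V ∧
    (∀ k : ℕ, k < r - 1 → S.C ⬝ᵥ (S.A ^ k).mulVec S.B = 0) ∧
    S.C ⬝ᵥ (S.A ^ (r - 1)).mulVec S.B ≠ 0

/-- The extended space `L_{2e}` of signals on the positive half-line. -/
def MemL2e (u : ℝ → ℝ) : Prop :=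
  ∀ T : ℝ, 0 < T → MeasureTheory.MemLp u 2 (MeasureTheory.volume.restrict (Set.Ioc 0 T))

/-- The energy `‖y‖²` of a signal in `L₂` of the positive half-line, possibly infinite. -/
def energy (y : ℝ → ℝ) : ℝ≥0∞ :=
  ∫⁻ t in Set.Ioi (0 : ℝ), ENNReal.ofReal (y t ^ 2)

/-- `x` is a (Carathéodory) solution on `[0, ∞)` of `x' = A x + B u` for the input `u`. -/
def IsTrajectory {V : Type*} [Fintype V] (A : Matrix V V ℝ) (B : V → ℝ)
    (u : ℝ → ℝ) (x : ℝ → V → ℝ) : Prop :=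
  ContinuousOn x (Set.Ici 0) ∧
    ∀ t : ℝ, 0 ≤ t → ∀ i : V, x t i = x 0 i + ∫ s in (0 : ℝ)..t, (A.mulVec (x s) i + B i * u s)

/-- The largest target energy over all inputs in `L_{2e}` and zero initial state, subject to the
monitor energy being at most `1`. -/
def worstCaseImpact {V : Type*} [Fintype V] (A : Matrix V V ℝ) (B Ct Cm : V → ℝ) : ℝ≥0∞ :=
  sSup {E | ∃ (u : ℝ → ℝ) (x : ℝ → V → ℝ), MemL2e u ∧ IsTrajectory A B u x ∧ x 0 = 0 ∧
    energy (fun t => Cm ⬝ᵥ x t) ≤ 1 ∧ E = energy (fun t => Ct ⬝ᵥ x t)}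

/-- The output-to-output gain: the least `γ > 0` such that the target energy is at most `γ` times
the monitor energy for all inputs in `L_{2e}` and zero initial state; it is `∞` if there is no
such `γ`. -/
def outputToOutputGain {V : Type*} [Fintype V] (A : Matrix V V ℝ) (B Ct Cm : V → ℝ) : ℝ≥0∞ :=
  sInf {E | ∃ γ : ℝ, 0 < γ ∧ E = ENNReal.ofReal γ ∧
    ∀ (u : ℝ → ℝ) (x : ℝ → V → ℝ), MemL2e u → IsTrajectory A B u x → x 0 = 0 →
      energy (fun t => Ct ⬝ᵥ x t) ≤ ENNReal.ofReal γ * energy (fun t => Cm ⬝ᵥ x t)}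

end NetAttack

end

/-!
# The output-to-output gain is finite exactly when the relative degrees are ordered

The argument works for arbitrary systems `(A, B, Ct)` and `(A, B, Cm)` that share their state
equation. For a monic polynomial `f` of degree `n` with `f(A) B = 0`, put
`g k = ∑ i, f.coeff (i + k) A ^ i B` (`krylov`). Then `A g (k + 1) = g k - f.coeff k B`, `g 0 = 0`
and `g n = B`, so that `x = ∑ k < n, w^(k) g (k + 1)` solves `x' = A x + B f(d/dt) w` for every
scalar signal `w`, the flat output. An output `c x` is then `N(d/dt) w` with
`N = ∑ k < n, (c g (k + 1)) X ^ k`, and relative degree `r` means `deg N = n - r`.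

If `rτ < rm`, take for `w` a smooth bump `ψ (ν t)`. Up to a common factor the target and monitor
energies are polynomials in `ν` of degrees `2 (n - rτ) > 2 (n - rm)` (`degree_energyPoly`), so their
ratio tends to infinity with `ν` (`worstCaseImpact_eq_top`).

If `rm ≤ rτ`, choose `f` of least degree. Then every root of the monitor polynomial `Nm` is an
invariant zero (`isInvariantZero_of_sum_eq_zero`), hence lies in the open left half-plane, and the
target is obtained from the monitor by the proper stable transfer function `Nτ / Nm`. As inputs are
only locally square integrable, the differential equations are integrated and read as equations over
the Volterra operator `I f = ∫ s in 0..t, f s`, a quasinilpotent endomorphism of the space of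
continuous signals: polynomials in `I` with nonzero constant term are invertible
(`isUnit_aeval_volterra`), which yields existence and uniqueness of the flat output
(`exists_flat_output`). The reversed polynomials satisfy `P(I) y_τ = Q(I) y_m`, with `deg Q ≤ deg P`
and all roots of `P` in the open left half-plane, and an energy estimate for scalar first order
equations shows that `Q(I) / P(I)` is bounded in `L₂` of every interval `[0, t]`, uniformly in `t`
(`exists_l2Bounded_aeval_mul_eq`). This bounds the gain (`outputToOutputGain_lt_top`), which in turn
bounds the impact.
-/

namespace NetAttack

/-! ### Krylov vectors and numerator polynomials -/

section

open Polynomial Matrix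

variable {R V : Type*} [CommRing R] [Fintype V] [DecidableEq V]

/-- The `k`-th tail `∑ i, f.coeff (i + k) A ^ i B` of the Horner scheme for `f(A) B`, where
`divX^[k] f` is `f` without its first `k` coefficients, shifted down. If `f(A) B = 0`, then the
polynomial `p(X) = ∑ k, krylov f A B (k + 1) X ^ k` solves `(X - A) p(X) = f(X) B`. -/
noncomputable def krylov (f : R[X]) (A : Matrix V V R) (B : V → R) (k : ℕ) : V → R :=
  (aeval A (divX^[k] f)).mulVec B

lemma coeff_divX_iterate (f : R[X]) (k i : ℕ) : (divX^[k] f).coeff i = f.coeff (i + k) := by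
  induction k generalizing i with
  | zero => rfl
  | succ k ih => rw [Function.iterate_succ_apply', coeff_divX, ih, add_assoc, add_comm 1 k]

lemma natDegree_divX_iterate (f : R[X]) (k : ℕ) :
    (divX^[k] f).natDegree = f.natDegree - k := by
  induction k with
  | zero => rfl
  | succ k ih => rw [Function.iterate_succ_apply', natDegree_divX_eq_natDegree_tsub_one, ih]; omega

lemma krylov_zero (f : R[X]) (A : Matrix V V R) (B : V → R) :
    krylov f A B 0 = (aeval A f).mulVec B := rfl

lemma mulVec_krylov_succ (f : R[X]) (A : Matrix V V R) (B : V → R) (k : ℕ) :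
    A.mulVec (krylov f A B (k + 1)) = krylov f A B k - f.coeff k • B := by
  have h := divX_mul_X_add (divX^[k] f)
  rw [coeff_divX_iterate, zero_add, ← Function.iterate_succ_apply' divX, mul_comm] at h
  have h2 := congrArg (fun p => (aeval A p).mulVec B) h
  simp only [map_add, map_mul, aeval_X, aeval_C, Matrix.add_mulVec] at h2
  rw [krylov, krylov, ← h2, Matrix.mulVec_mulVec]
  simp [Algebra.algebraMap_eq_smul_one, Matrix.smul_mulVec]

lemma krylov_natDegree {f : R[X]} (hf : f.Monic) (A : Matrix V V R) (B : V → R) :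
    krylov f A B f.natDegree = B := by
  have : divX^[f.natDegree] f = 1 := by
    refine eq_one_of_monic_natDegree_zero ?_ (by simp [natDegree_divX_iterate])
    rw [Monic, leadingCoeff, natDegree_divX_iterate, coeff_divX_iterate]
    simp [hf]
  simp [krylov, this]

lemma dotProduct_aeval_mulVec (p : R[X]) (A : Matrix V V R) (B c : V → R) {N : ℕ}
    (hN : p.natDegree < N) :
    c ⬝ᵥ (aeval A p).mulVec B =
      ∑ i ∈ Finset.range N, p.coeff i * (c ⬝ᵥ (A ^ i).mulVec B) := by
  rw [aeval_eq_sum_range' hN, Matrix.sum_mulVec, dotProduct_sum]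
  simp [Matrix.smul_mulVec]

variable {f : R[X]} {A : Matrix V V R} {B c : V → R} {r : ℕ}

lemma dotProduct_krylov_eq_zero (h0 : ∀ k < r - 1, c ⬝ᵥ (A ^ k).mulVec B = 0) {k : ℕ}
    (hk : f.natDegree < k + r) (hr : 1 ≤ r) (hk' : k < f.natDegree) :
    c ⬝ᵥ krylov f A B (k + 1) = 0 := by
  rw [krylov, dotProduct_aeval_mulVec _ A B c (Nat.lt_succ_self _)]
  refine Finset.sum_eq_zero fun i hi => ?_
  rw [Finset.mem_range, natDegree_divX_iterate] at hi
  rw [h0 i (by omega), mul_zero]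

lemma dotProduct_krylov_natDegree_sub (hf : f.Monic)
    (h0 : ∀ k < r - 1, c ⬝ᵥ (A ^ k).mulVec B = 0) (hr : 1 ≤ r) (hrn : r ≤ f.natDegree) :
    c ⬝ᵥ krylov f A B (f.natDegree - r + 1) = c ⬝ᵥ (A ^ (r - 1)).mulVec B := by
  rw [krylov, dotProduct_aeval_mulVec _ A B c (N := r - 1 + 1)
    (by rw [natDegree_divX_iterate]; omega), Finset.sum_range_succ,
    Finset.sum_eq_zero (fun i hi => by rw [h0 i (Finset.mem_range.1 hi), mul_zero]), zero_add,
    coeff_divX_iterate, show r - 1 + (f.natDegree - r + 1) = f.natDegree by omega,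
    hf.coeff_natDegree, one_mul]

/-- A polynomial annihilating `B` yields a recursion for the Markov parameters `c A ^ k B`, so
the first nonzero one occurs early. -/
lemma le_natDegree_of_markov_ne_zero (hf : f.Monic) (hB : (aeval A f).mulVec B = 0)
    (h0 : ∀ k < r - 1, c ⬝ᵥ (A ^ k).mulVec B = 0) (hr : 1 ≤ r)
    (h1 : c ⬝ᵥ (A ^ (r - 1)).mulVec B ≠ 0) : r ≤ f.natDegree := by
  by_contra! hlt
  apply h1
  have h2 : (aeval A (X ^ (r - 1 - f.natDegree) * f)).mulVec B = 0 := by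
    rw [map_mul, ← Matrix.mulVec_mulVec, hB, Matrix.mulVec_zero]
  have hm : (X ^ (r - 1 - f.natDegree) * f).Monic := (monic_X_pow _).mul hf
  have hd : (X ^ (r - 1 - f.natDegree) * f).natDegree = r - 1 := by
    nontriviality R
    rw [(monic_X_pow _).natDegree_mul hf, natDegree_X_pow]; omega
  have h3 := dotProduct_aeval_mulVec (X ^ (r - 1 - f.natDegree) * f) A B c (N := r - 1 + 1)
    (by omega)
  rw [h2, dotProduct_zero, Finset.sum_range_succ, Finset.sum_eq_zero
    (fun i hi => by rw [h0 i (Finset.mem_range.1 hi), mul_zero]), zero_add] at h3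
  have h4 := hm.coeff_natDegree
  rw [hd] at h4
  rw [h4, one_mul] at h3
  exact h3.symm

/-- The pair `(∑ k, s ^ k krylov (k + 1), f(s))` solves the state equation of the Rosenbrock
system at `s`. -/
lemma smul_sub_mulVec_sum_krylov (hf : f.Monic) (hB : (aeval A f).mulVec B = 0) (s : R) :
    (s • (1 : Matrix V V R) - A).mulVec
      (∑ k ∈ Finset.range f.natDegree, s ^ k • krylov f A B (k + 1)) = f.eval s • B := by
  have hterm : ∀ k, (s • (1 : Matrix V V R) - A).mulVec (s ^ k • krylov f A B (k + 1)) =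
      (s ^ (k + 1) • krylov f A B (k + 1) - s ^ k • krylov f A B k) +
        (f.coeff k * s ^ k) • B := by
    intro k
    rw [Matrix.mulVec_smul, Matrix.sub_mulVec, Matrix.smul_mulVec, Matrix.one_mulVec,
      mulVec_krylov_succ, pow_succ]
    module
  rw [Matrix.mulVec_sum, Finset.sum_congr rfl fun k _ => hterm k, Finset.sum_add_distrib,
    Finset.sum_range_sub (fun k => s ^ k • krylov f A B k), krylov_natDegree hf, krylov_zero, hB,
    ← Finset.sum_smul, eval_eq_sum_range, Finset.sum_range_succ, hf.coeff_natDegree]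
  module

/-- If `f` has minimal degree among the monic polynomials annihilating `B`, then the state component
`∑ k, s ^ k krylov (k + 1)` does not vanish at any `s`: it is `p(A) B` for a monic `p` of degree
`deg f - 1`. -/
lemma sum_krylov_ne_zero {K : Type*} [Field K] {f : K[X]} {A : Matrix V V K} {B : V → K}
    (hf : f.Monic) (hn : 0 < f.natDegree)
    (hmin : ∀ p : K[X], p.Monic → (aeval A p).mulVec B = 0 → f.natDegree ≤ p.natDegree) (s : K) :
    ∑ k ∈ Finset.range f.natDegree, s ^ k • krylov f A B (k + 1) ≠ 0 := by
  set p : K[X] := ∑ k ∈ Finset.range f.natDegree, s ^ k • divX^[k + 1] f with hp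
  have hcoeff : ∀ i, p.coeff i =
      ∑ k ∈ Finset.range f.natDegree, s ^ k * f.coeff (i + (k + 1)) := by
    intro i
    simp only [hp, finsetSum_coeff, coeff_smul, coeff_divX_iterate, smul_eq_mul]
  have hdeg : p.natDegree ≤ f.natDegree - 1 := by
    rw [natDegree_le_iff_coeff_eq_zero]
    intro i hi
    rw [hcoeff]
    refine Finset.sum_eq_zero fun k _ => ?_
    rw [coeff_eq_zero_of_natDegree_lt (by omega), mul_zero]
  have hlead : p.coeff (f.natDegree - 1) = 1 := by
    rw [hcoeff, Finset.sum_eq_single_of_mem 0 (Finset.mem_range.2 hn)]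
    · rw [pow_zero, one_mul, show f.natDegree - 1 + (0 + 1) = f.natDegree by omega,
        hf.coeff_natDegree]
    · intro k _ hk
      rw [coeff_eq_zero_of_natDegree_lt (by omega), mul_zero]
  have hmon : p.Monic := monic_of_natDegree_le_of_coeff_eq_one _ hdeg hlead
  intro h
  have h2 : (aeval A p).mulVec B = 0 := by
    rw [← h, hp, map_sum, Matrix.sum_mulVec]
    simp [krylov, Matrix.smul_mulVec]
  have := hmin p hmon h2
  omega

/-- A monic annihilator of `B` of least degree. -/
lemma exists_minimal_annihilator {K : Type*} [Field K] (A : Matrix V V K) (B : V → K) :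
    ∃ f : K[X], f.Monic ∧ (aeval A f).mulVec B = 0 ∧
      ∀ p : K[X], p.Monic → (aeval A p).mulVec B = 0 → f.natDegree ≤ p.natDegree := by
  have hne : {p : K[X] | p.Monic ∧ (aeval A p).mulVec B = 0}.Nonempty :=
    ⟨A.charpoly, A.charpoly_monic, by rw [Matrix.aeval_self_charpoly, Matrix.zero_mulVec]⟩
  obtain ⟨f, hf, hmin⟩ := exists_minimalFor_of_wellFoundedLT _ natDegree hne
  refine ⟨f, hf.1, hf.2, fun p hp hpB => ?_⟩
  by_contra! hlt
  exact absurd (hmin ⟨hp, hpB⟩ hlt.le) (by omega)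

end

/-! ### The Volterra operator -/

section

open Polynomial

section Algebra

variable {E : Type*} [Ring E] [Algebra ℂ E] {a : E}

/-- The spectral mapping argument for an element with spectrum contained in `{0}`. -/
lemma isUnit_aeval_of_isUnit_sub (ha : ∀ ρ : ℂ, ρ ≠ 0 → IsUnit (a - algebraMap ℂ E ρ)) {p : ℂ[X]}
    (hp : p.coeff 0 ≠ 0) : IsUnit (aeval a p) := by
  have hp0 : p ≠ 0 := by rintro rfl; simp at hp
  rw [(IsAlgClosed.splits p).eq_prod_roots, map_mul, aeval_C]
  refine IsUnit.mul ((isUnit_iff_ne_zero.2 (leadingCoeff_ne_zero.2 hp0)).map _) ?_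
  by_contra hu
  obtain ⟨k, hk, hk0⟩ := spectrum.exists_mem_of_not_isUnit_aeval_prod hu
  have hk' : k ≠ 0 := by
    rintro rfl
    rw [← coeff_zero_eq_eval_zero] at hk0
    exact hp hk0
  rw [spectrum.mem_iff] at hk
  exact hk (by simpa using (ha k hk').neg)

lemma resolvent_eq {ρ : ℂ} (hρ : ρ ≠ 0) {b : E} (hb : (a - algebraMap ℂ E ρ) * b = 1) :
    b = algebraMap ℂ E ρ⁻¹ * (a * b - 1) := by
  rw [← hb, sub_mul, sub_sub_cancel, ← mul_assoc, ← map_mul, inv_mul_cancel₀ hρ, map_one, one_mul]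

lemma resolvent_mem {S : Subalgebra ℂ E} {ρ : ℂ} (hρ : ρ ≠ 0) {b : E}
    (hb : (a - algebraMap ℂ E ρ) * b = 1) (hab : a * b ∈ S) : b ∈ S := by
  rw [resolvent_eq hρ hb]
  exact S.mul_mem (S.algebraMap_mem _) (S.sub_mem hab S.one_mem)

/-- Let the resolvent `b` of `a` at every `ρ` with `Re ρ < 0` satisfy `b ∈ S` and `a * b ∈ S`. Then
`S` contains `Q(a) / P(a)` whenever `deg Q ≤ deg P` and the roots of `P` have negative real part:
split a root `ρ` off `P` and write `Q = Q(0) + X Q'`. -/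
lemma exists_mem_aeval_mul_eq {S : Subalgebra ℂ E}
    (hS : ∀ ρ : ℂ, ρ.re < 0 → ∃ b ∈ S, (a - algebraMap ℂ E ρ) * b = 1 ∧ a * b ∈ S) (d : ℕ) :
    ∀ P : ℂ[X], P.natDegree = d → P ≠ 0 → (∀ ρ, P.IsRoot ρ → ρ.re < 0) →
    ∀ Q : ℂ[X], Q.natDegree ≤ d → ∃ T ∈ S, aeval a P * T = aeval a Q := by
  induction d with
  | zero =>
    intro P hP hP0 _ Q hQ
    rw [eq_C_of_natDegree_eq_zero hP] at hP0 ⊢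
    rw [eq_C_of_natDegree_le_zero hQ]
    refine ⟨algebraMap ℂ E ((P.coeff 0)⁻¹ * Q.coeff 0), S.algebraMap_mem _, ?_⟩
    rw [aeval_C, aeval_C, ← map_mul, mul_inv_cancel_left₀ (by simpa using hP0)]
  | succ d ih =>
    intro P hP hP0 hroots Q hQ
    obtain ⟨ρ, hρ⟩ := IsAlgClosed.exists_root P
      (fun h => by rw [natDegree_eq_of_degree_eq_some (n := 0) h] at hP; omega)
    obtain ⟨P', rfl⟩ := dvd_iff_isRoot.2 hρ
    have hP'0 : P' ≠ 0 := right_ne_zero_of_mul hP0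
    have hP'd : P'.natDegree = d := by
      rw [natDegree_mul (X_sub_C_ne_zero ρ) hP'0, natDegree_X_sub_C] at hP
      omega
    have hroots' : ∀ σ, P'.IsRoot σ → σ.re < 0 := fun σ hσ =>
      hroots σ (hσ.dvd (dvd_mul_left _ _))
    obtain ⟨R, hR, hR1, hIR⟩ := hS ρ (hroots ρ hρ)
    obtain ⟨T₀, hT₀, h₀⟩ := ih P' hP'd hP'0 hroots' (C (Q.coeff 0)) (by simp)
    obtain ⟨T₁, hT₁, h₁⟩ := ih P' hP'd hP'0 hroots' (divX Q)
      (by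
        rw [natDegree_divX_eq_natDegree_tsub_one]
        omega)
    refine ⟨R * T₀ + a * R * T₁, add_mem (mul_mem hR hT₀) (mul_mem hIR hT₁), ?_⟩
    have hX : aeval a ((X - C ρ) * P') =
        aeval a P' * (a - algebraMap ℂ E ρ) := by
      rw [mul_comm, map_mul]; simp
    have hc1 : (a - algebraMap ℂ E ρ) * a =
        a * (a - algebraMap ℂ E ρ) := by
      rw [sub_mul, mul_sub, Algebra.commutes]
    have hc2 : aeval a P' * a = a * aeval a P' := by
      have := congrArg (aeval a) (mul_comm P' X)
      simpa using this
    calc aeval a ((X - C ρ) * P') * (R * T₀ + a * R * T₁)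
        = aeval a P' * ((a - algebraMap ℂ E ρ) * R) * T₀ +
          aeval a P' * ((a - algebraMap ℂ E ρ) * a) * (R * T₁) := by
          rw [hX]; noncomm_ring
      _ = aeval a P' * T₀ + a * (aeval a P' * T₁) := by
          rw [hc1, hR1, mul_one]
          congr 1
          calc aeval a P' * (a * (a - algebraMap ℂ E ρ)) * (R * T₁)
              = (aeval a P' * a) * ((a - algebraMap ℂ E ρ) * R) * T₁ := by noncomm_ring
            _ = a * (aeval a P' * T₁) := by rw [hc2, hR1, mul_one, mul_assoc]
      _ = aeval a Q := by
          have hQ := congrArg (aeval a) (divX_mul_X_add Q)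
          rw [mul_comm, map_add, map_mul, aeval_X] at hQ
          rw [h₀, h₁, add_comm, hQ]

end Algebra

section Volterra

/-- The Volterra operator `(I f)(t) = ∫ s in 0..t, f s` on continuous signals `ℝ → ℂ`. -/
noncomputable def volterra : Module.End ℂ C(ℝ, ℂ) where
  toFun f := ⟨fun t => ∫ s in (0 : ℝ)..t, f s,
    intervalIntegral.continuous_primitive (fun _ _ => f.continuous.intervalIntegrable _ _) 0⟩
  map_add' f g := by
    ext t
    exact intervalIntegral.integral_add (f.continuous.intervalIntegrable _ _)
      (g.continuous.intervalIntegrable _ _)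
  map_smul' c f := by
    ext t
    exact intervalIntegral.integral_smul c f

lemma volterra_apply (f : C(ℝ, ℂ)) (t : ℝ) : volterra f t = ∫ s in (0 : ℝ)..t, f s := rfl

lemma volterra_apply_zero (f : C(ℝ, ℂ)) : volterra f 0 = 0 := by simp [volterra_apply]

lemma hasDerivAt_volterra (f : C(ℝ, ℂ)) (t : ℝ) : HasDerivAt (fun t => volterra f t) (f t) t :=
  intervalIntegral.integral_hasDerivAt_right (f.continuous.intervalIntegrable _ _)
    f.continuous.stronglyMeasurable.stronglyMeasurableAtFilter f.continuous.continuousAt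

/-- A differentiable signal that vanishes at `0` is the primitive of its derivative. -/
lemma volterra_eq_of_hasDerivAt {f g : C(ℝ, ℂ)} (h : ∀ t, HasDerivAt (fun t => g t) (f t) t)
    (h0 : g 0 = 0) : volterra f = g := by
  ext t
  rw [volterra_apply, intervalIntegral.integral_eq_sub_of_hasDerivAt (fun s _ => h s)
    (f.continuous.intervalIntegrable _ _), h0, sub_zero]

/-- A signal with `g' = l g` that vanishes at `0` is zero, as `exp (-l t) g(t)` is constant. -/
lemma eq_zero_of_hasDerivAt_smul {g : ℝ → ℂ} {l : ℂ} (h : ∀ t, HasDerivAt g (l * g t) t)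
    (h0 : g 0 = 0) (t : ℝ) : g t = 0 := by
  have hexp : ∀ t : ℝ, HasDerivAt (fun t : ℝ => Complex.exp (-l * t))
      (Complex.exp (-l * t) * -l) t := fun t => by
    simpa using (((hasDerivAt_id (t : ℂ)).const_mul (-l)).cexp).comp_ofReal
  have hc : ∀ t, HasDerivAt (fun t : ℝ => Complex.exp (-l * t) * g t) 0 t := fun t => by
    convert! (hexp t).mul (h t) using 1
    ring
  have := is_const_of_deriv_eq_zero (fun t => (hc t).differentiableAt) (fun t => (hc t).deriv) t 0
  simpa [h0] using this

/-- The Volterra operator is quasinilpotent: the equation `I v - ρ v = f` is the scalar linear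
differential equation `g' = ρ⁻¹ (g - f)` for `g = I v`, and variation of constants solves it. -/
lemma isUnit_volterra_sub {ρ : ℂ} (hρ : ρ ≠ 0) :
    IsUnit (volterra - algebraMap ℂ (Module.End ℂ C(ℝ, ℂ)) ρ) := by
  rw [Module.End.isUnit_iff]
  constructor
  · rw [injective_iff_map_eq_zero]
    intro v hv
    have hv' : ∀ t, volterra v t = ρ * v t := fun t => by
      have := DFunLike.congr_fun hv t
      simpa [Module.algebraMap_end_apply, sub_eq_zero] using this
    have hg : ∀ t, volterra v t = 0 := by
      refine eq_zero_of_hasDerivAt_smul (l := ρ⁻¹) (fun t => ?_) (volterra_apply_zero v)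
      rw [hv', inv_mul_cancel_left₀ hρ]
      exact hasDerivAt_volterra v t
    ext t
    simpa [hg, hρ] using hv' t
  · intro f
    set l := ρ⁻¹ with hl
    have hexp : ∀ (c : ℂ) (t : ℝ), HasDerivAt (fun t : ℝ => Complex.exp (c * t))
        (Complex.exp (c * t) * c) t := fun c t => by
      simpa using (((hasDerivAt_id (t : ℂ)).const_mul c).cexp).comp_ofReal
    let e : ℂ → C(ℝ, ℂ) := fun c => ⟨fun t => Complex.exp (c * t), by fun_prop⟩
    let G : C(ℝ, ℂ) := e l * volterra (e (-l) * f)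
    have hG : ∀ t, HasDerivAt (fun t => G t) (l * G t + f t) t := fun t => by
      convert! (hexp l t).mul (hasDerivAt_volterra (e (-l) * f) t) using 1
      have : Complex.exp (l * t) * Complex.exp (-l * t) = 1 := by
        rw [← Complex.exp_add]; simp
      simp only [G, e, ContinuousMap.mul_apply, ContinuousMap.coe_mk]
      linear_combination (-f t) * this
    have hG0 : G 0 = 0 := by simp [G, volterra_apply_zero]
    have hI : volterra (-l • (l • G + f)) = -l • G := by
      refine volterra_eq_of_hasDerivAt (fun t => ?_) (by simp [hG0])
      simpa using (hG t).const_mul (-l)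
    refine ⟨-l • (l • G + f), ?_⟩
    rw [LinearMap.sub_apply, hI, Module.algebraMap_end_apply, smul_smul, hl]
    rw [mul_neg, mul_inv_cancel₀ hρ]
    module

/-- A polynomial in the Volterra operator with nonzero constant term is invertible, because the
spectrum of the Volterra operator is contained in `{0}`. -/
lemma isUnit_aeval_volterra {p : ℂ[X]} (hp : p.coeff 0 ≠ 0) : IsUnit (aeval volterra p) := by
  refine isUnit_aeval_of_isUnit_sub (E := Module.End ℂ C(ℝ, ℂ)) (fun ρ hρ => ?_) hp
  exact isUnit_volterra_sub hρ

lemma aeval_volterra_injective {p : ℂ[X]} (hp : p.coeff 0 ≠ 0) :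
    Function.Injective (aeval volterra p) :=
  ((Module.End.isUnit_iff _).1 (isUnit_aeval_volterra hp)).injective

/-- The operators that are bounded for the `L₂` norms on the intervals `[0, t]`, uniformly
in `t ≥ 0`. -/
noncomputable def l2Bounded : Subalgebra ℂ (Module.End ℂ C(ℝ, ℂ)) where
  carrier := {T | ∃ K : ℝ, 0 ≤ K ∧ ∀ (f : C(ℝ, ℂ)) (t : ℝ), 0 ≤ t →
    ∫ s in (0 : ℝ)..t, ‖T f s‖ ^ 2 ≤ K * ∫ s in (0 : ℝ)..t, ‖f s‖ ^ 2}
  mul_mem' := by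
    rintro S T ⟨K, hK, hS⟩ ⟨K', hK', hT⟩
    refine ⟨K * K', mul_nonneg hK hK', fun f t ht => (hS (T f) t ht).trans ?_⟩
    rw [mul_assoc]
    exact mul_le_mul_of_nonneg_left (hT f t ht) hK
  add_mem' := by
    rintro S T ⟨K, hK, hS⟩ ⟨K', hK', hT⟩
    refine ⟨2 * (K + K'), by positivity, fun f t ht => ?_⟩
    have hi : ∀ g : C(ℝ, ℂ), IntervalIntegrable (fun s => ‖g s‖ ^ 2) MeasureTheory.volume 0 t :=
      fun g => (by fun_prop : Continuous fun s => ‖g s‖ ^ 2).intervalIntegrable _ _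
    calc ∫ s in (0 : ℝ)..t, ‖(S + T) f s‖ ^ 2
        ≤ ∫ s in (0 : ℝ)..t, (2 * ‖S f s‖ ^ 2 + 2 * ‖T f s‖ ^ 2) := by
          refine intervalIntegral.integral_mono_on ht (hi _)
            (((hi (S f)).const_mul 2).add ((hi (T f)).const_mul 2)) fun s _ => ?_
          have h1 := norm_add_le (S f s) (T f s)
          have h2 : ‖(S + T) f s‖ ≤ ‖S f s‖ + ‖T f s‖ := h1
          nlinarith [sq_nonneg (‖S f s‖ - ‖T f s‖), norm_nonneg ((S + T) f s)]
      _ = 2 * (∫ s in (0 : ℝ)..t, ‖S f s‖ ^ 2) + 2 * ∫ s in (0 : ℝ)..t, ‖T f s‖ ^ 2 := by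
          rw [intervalIntegral.integral_add ((hi (S f)).const_mul 2) ((hi (T f)).const_mul 2),
            intervalIntegral.integral_const_mul, intervalIntegral.integral_const_mul]
      _ ≤ 2 * (K + K') * ∫ s in (0 : ℝ)..t, ‖f s‖ ^ 2 := by
          linarith [hS f t ht, hT f t ht]
  algebraMap_mem' c := by
    refine ⟨‖c‖ ^ 2, by positivity, fun f t _ => ?_⟩
    rw [← intervalIntegral.integral_const_mul]
    simp [Module.algebraMap_end_apply, mul_pow]

/-- The energy estimate for `g' = l (g - f)`, `Re l < 0`: integrating
`(|g|²)' ≤ Re l |g|² + |l|² / |Re l| |f|²` bounds the energy of `g` by that of `f`. -/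
lemma integral_norm_sq_le_of_hasDerivAt {f g : C(ℝ, ℂ)} {l : ℂ} (hl : l.re < 0)
    (h : ∀ t, HasDerivAt (fun t => g t) (l * (g t - f t)) t) (h0 : g 0 = 0) {t : ℝ} (ht : 0 ≤ t) :
    ∫ s in (0 : ℝ)..t, ‖g s‖ ^ 2 ≤ (‖l‖ ^ 2 / l.re ^ 2) * ∫ s in (0 : ℝ)..t, ‖f s‖ ^ 2 := by
  have hd : ∀ s, HasDerivAt (fun s => ‖g s‖ ^ 2) (2 * inner ℝ (g s) (l * (g s - f s))) s :=
    fun s => (h s).norm_sq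
  have hi : ∀ g : C(ℝ, ℂ), IntervalIntegrable (fun s => ‖g s‖ ^ 2) MeasureTheory.volume 0 t :=
    fun g => (by fun_prop : Continuous fun s => ‖g s‖ ^ 2).intervalIntegrable _ _
  have hfi : IntervalIntegrable (fun s => 2 * inner ℝ (g s) (l * (g s - f s)))
      MeasureTheory.volume 0 t := by
    refine Continuous.intervalIntegrable ?_ _ _
    fun_prop
  have hftc := intervalIntegral.integral_eq_sub_of_hasDerivAt (fun s _ => hd s) hfi
  have hmono : ∫ s in (0 : ℝ)..t, 2 * inner ℝ (g s) (l * (g s - f s)) ≤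
      ∫ s in (0 : ℝ)..t, (l.re * ‖g s‖ ^ 2 + (‖l‖ ^ 2 / -l.re) * ‖f s‖ ^ 2) := by
    refine intervalIntegral.integral_mono_on ht hfi
      (((hi g).const_mul _).add ((hi f).const_mul _)) fun s _ => ?_
    have e1 : inner ℝ (g s) (l * (g s - f s)) = l.re * ‖g s‖ ^ 2 - inner ℝ (g s) (l * f s) := by
      rw [mul_sub, inner_sub_right, Complex.inner, Complex.inner, ← Complex.normSq_eq_norm_sq,
        Complex.normSq_apply]
      simp
      ring
    have e2 : -inner ℝ (g s) (l * f s) ≤ ‖g s‖ * (‖l‖ * ‖f s‖) := by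
      rw [← norm_mul, ← inner_neg_right]
      simpa using real_inner_le_norm (g s) (-(l * f s))
    have e3 : 2 * (‖g s‖ * (‖l‖ * ‖f s‖)) ≤ -l.re * ‖g s‖ ^ 2 + ‖l‖ ^ 2 / -l.re * ‖f s‖ ^ 2 := by
      have hk : 0 < -l.re := by linarith
      have : -l.re * ‖g s‖ ^ 2 + ‖l‖ ^ 2 / -l.re * ‖f s‖ ^ 2 - 2 * (‖g s‖ * (‖l‖ * ‖f s‖)) =
          (-l.re * ‖g s‖ - ‖l‖ * ‖f s‖) ^ 2 / -l.re := by
        have hne : l.re ≠ 0 := hl.ne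
        field_simp
        ring
      have h5 := div_nonneg (sq_nonneg (-l.re * ‖g s‖ - ‖l‖ * ‖f s‖)) hk.le
      linarith
    rw [e1]
    linarith
  rw [intervalIntegral.integral_add ((hi g).const_mul _) ((hi f).const_mul _),
    intervalIntegral.integral_const_mul (l.re), intervalIntegral.integral_const_mul (_ / _), hftc,
    h0] at hmono
  have hk : 0 < -l.re := by linarith
  have h1 : -l.re * ∫ s in (0 : ℝ)..t, ‖g s‖ ^ 2 ≤
      (‖l‖ ^ 2 / -l.re) * ∫ s in (0 : ℝ)..t, ‖f s‖ ^ 2 := by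
    have := sq_nonneg ‖g t‖
    simp at hmono
    linarith
  have h2 : ‖l‖ ^ 2 / l.re ^ 2 = (‖l‖ ^ 2 / -l.re) / -l.re := by rw [div_div, neg_mul_neg, sq l.re]
  rw [h2, div_mul_eq_mul_div, le_div_iff₀ hk]
  linarith

/-- For `Re ρ < 0` the resolvent `R` of the Volterra operator at `ρ` is bounded, and so is `I R`. -/
lemma exists_l2Bounded_resolvent {ρ : ℂ} (hρ : ρ.re < 0) :
    ∃ R ∈ l2Bounded, (volterra - algebraMap ℂ (Module.End ℂ C(ℝ, ℂ)) ρ) * R = 1 ∧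
      volterra * R ∈ l2Bounded := by
  have hρ0 : ρ ≠ 0 := by rintro rfl; simp at hρ
  obtain ⟨R, hR⟩ := (isUnit_volterra_sub hρ0).exists_right_inv
  have hl : (ρ⁻¹).re < 0 := by
    rw [Complex.inv_re]
    exact div_neg_of_neg_of_pos hρ (Complex.normSq_pos.2 hρ0)
  have hR' : R = algebraMap ℂ (Module.End ℂ C(ℝ, ℂ)) ρ⁻¹ * (volterra * R - 1) :=
    resolvent_eq (E := Module.End ℂ C(ℝ, ℂ)) hρ0 hR
  have hIR : volterra * R ∈ l2Bounded := by
    refine ⟨_, by positivity, fun f t ht =>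
      integral_norm_sq_le_of_hasDerivAt (l := ρ⁻¹) hl (fun s => ?_) (volterra_apply_zero _) ht⟩
    convert! hasDerivAt_volterra (R f) s using 1
    nth_rw 2 [hR']
    simp [Module.algebraMap_end_apply]
  exact ⟨R, resolvent_mem (E := Module.End ℂ C(ℝ, ℂ)) hρ0 hR hIR, hR, hIR⟩

/-- A proper rational function of the Volterra operator is bounded if its poles lie in the open
left half-plane. -/
lemma exists_l2Bounded_aeval_mul_eq {P Q : ℂ[X]} (hP : P ≠ 0)
    (hroots : ∀ ρ, P.IsRoot ρ → ρ.re < 0) (hQ : Q.natDegree ≤ P.natDegree) :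
    ∃ T ∈ l2Bounded, aeval volterra P * T = aeval volterra Q :=
  exists_mem_aeval_mul_eq (E := Module.End ℂ C(ℝ, ℂ)) (S := l2Bounded)
    (fun _ hρ => exists_l2Bounded_resolvent hρ) P.natDegree P rfl hP hroots Q hQ

end Volterra

end

/-! ### The integrated state equation -/

section

open Polynomial Matrix

section RevPoly

variable {R : Type*} [CommRing R]

/-- The polynomial `∑ k ≤ n, c k X ^ (n - k)`, which is `X ^ n p(1 / X)` for
`p = ∑ k ≤ n, c k X ^ k`: a polynomial in `d/dt` becomes one in the Volterra operator. -/
noncomputable def revPoly (c : ℕ → R) (n : ℕ) : R[X] :=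
  ∑ k ∈ Finset.range (n + 1), C (c k) * X ^ (n - k)

lemma coeff_revPoly (c : ℕ → R) {n k : ℕ} (hk : k ≤ n) : (revPoly c n).coeff (n - k) = c k := by
  rw [revPoly, finsetSum_coeff, Finset.sum_eq_single_of_mem k (by simp; omega)]
  · simp
  · intro j hj hjk
    rw [Finset.mem_range] at hj
    rw [coeff_C_mul, coeff_X_pow, if_neg (by omega), mul_zero]

lemma natDegree_revPoly_le (c : ℕ → R) (n : ℕ) : (revPoly c n).natDegree ≤ n :=
  natDegree_sum_le_of_forall_le _ _ fun _ _ =>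
    (natDegree_C_mul_X_pow_le _ _).trans (Nat.sub_le _ _)

lemma revPoly_eq_X_pow_mul {c : ℕ → R} {n j : ℕ} (hj : j ≤ n)
    (h : ∀ k ≤ n, n - j < k → c k = 0) : revPoly c n = X ^ j * revPoly c (n - j) := by
  have hsub : Finset.range (n - j + 1) ⊆ Finset.range (n + 1) :=
    Finset.range_subset_range.2 (by omega)
  rw [revPoly, revPoly, Finset.mul_sum, ← Finset.sum_subset hsub]
  · refine Finset.sum_congr rfl fun k hk => ?_
    rw [Finset.mem_range] at hk
    rw [mul_left_comm, ← pow_add, show j + (n - j - k) = n - k by omega]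
  · intro k hk hk'
    rw [Finset.mem_range] at hk hk'
    rw [h k (by omega) (by omega), C_0, zero_mul]

lemma aeval_revPoly {E : Type*} [Ring E] [Algebra R E] (a : E) (c : ℕ → R) (n : ℕ) :
    aeval a (revPoly c n) = ∑ k ∈ Finset.range (n + 1), c k • a ^ (n - k) := by
  simp [revPoly, map_sum, Algebra.smul_def]

/-- The roots of `revPoly c n` are the inverses of the nonzero roots of `∑ k, c k X ^ k`. -/
lemma sum_inv_pow_eq_zero_of_isRoot {K : Type*} [Field K] {c : ℕ → K} {n : ℕ} {ρ : K}
    (hρ : ρ ≠ 0) (h : (revPoly c n).IsRoot ρ) :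
    ∑ k ∈ Finset.range (n + 1), c k * ρ⁻¹ ^ k = 0 := by
  have h' : ∑ k ∈ Finset.range (n + 1), c k * ρ ^ (n - k) = 0 := by
    simpa [IsRoot, revPoly, eval_finsetSum] using h
  rw [← mul_zero (ρ⁻¹ ^ n), ← h', Finset.mul_sum]
  refine Finset.sum_congr rfl fun k hk => ?_
  obtain ⟨j, rfl⟩ := Nat.exists_eq_add_of_le (Nat.lt_succ_iff.1 (Finset.mem_range.1 hk))
  rw [Nat.add_sub_cancel_left, mul_left_comm, pow_add, mul_assoc, ← mul_pow, inv_mul_cancel₀ hρ,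
    one_pow, mul_one]

end RevPoly

section IntegralEquation

variable {M V : Type*} [AddCommGroup M] [Module ℂ M] [Fintype V] [DecidableEq V]
  {I : Module.End ℂ M} {A : Matrix V V ℂ}

open scoped Matrix.Module in
/-- Uniqueness for the integrated state equation `v = I A v`: iteration gives `v = I ^ k A ^ k v`,
so by Cayley-Hamilton the reversed characteristic polynomial of `A`, evaluated at `I`,
annihilates `v`. -/
lemma eq_zero_of_eq_apply_mulVec
    (hI : ∀ p : ℂ[X], p.coeff 0 ≠ 0 → Function.Injective (aeval I p)) {v : V → M}
    (hv : ∀ i, v i = I (∑ j, A i j • v j)) : v = 0 := by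
  have hpow : ∀ k i, v i = (I ^ k) ((A ^ k • v) i) := by
    intro k
    induction k with
    | zero => exact fun i => by rw [pow_zero, pow_zero, one_smul, Module.End.one_apply]
    | succ k ih =>
      intro i
      rw [pow_succ' A, mul_smul, Matrix.Module.smul_apply, pow_succ', Module.End.mul_apply, map_sum]
      simp only [map_smul]
      rw [hv i]
      simp only [← ih]
  set n := A.charpoly.natDegree with hn
  have h0 : (revPoly A.charpoly.coeff n).coeff 0 ≠ 0 := by
    have := coeff_revPoly A.charpoly.coeff (le_refl n)
    rw [Nat.sub_self] at this
    rw [this, hn, A.charpoly_monic.coeff_natDegree]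
    exact one_ne_zero
  ext i
  refine hI _ h0 ?_
  have hterm : ∀ k ∈ Finset.range (n + 1),
      (A.charpoly.coeff k • I ^ (n - k)) (v i) = (I ^ n) (((A.charpoly.coeff k • A ^ k) • v) i) := by
    intro k hk
    rw [Finset.mem_range] at hk
    conv_lhs => rw [hpow k i]
    rw [LinearMap.smul_apply, ← Module.End.mul_apply, ← pow_add, Nat.sub_add_cancel (by omega),
      ← map_smul]
    congr 1
    simp [Finset.smul_sum, mul_smul]
  rw [aeval_revPoly, LinearMap.sum_apply, Finset.sum_congr rfl hterm, ← map_sum,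
    ← Finset.sum_apply, ← Finset.sum_smul, ← aeval_eq_sum_range, Matrix.aeval_self_charpoly]
  simp

/-- The flat output: if `f(A) B = 0` with `f` monic of degree `n`, then every solution of the
integrated state equation `x = I A x + B U` has the form
`x = ∑ k < n, I ^ (n - 1 - k) w krylov (k + 1)` for a scalar signal `w`. -/
lemma exists_flat_output {B : V → ℂ} {f : ℂ[X]}
    (hI : ∀ p : ℂ[X], p.coeff 0 ≠ 0 → Function.Bijective (aeval I p))
    (hf : f.Monic) (hB : (aeval A f).mulVec B = 0) {x : V → M} {U : M}
    (hx : ∀ i, x i = I (∑ j, A i j • x j) + B i • U) :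
    ∃ w : M, ∀ i, x i = ∑ k ∈ Finset.range f.natDegree,
      krylov f A B (k + 1) i • (I ^ (f.natDegree - 1 - k)) w := by
  set n := f.natDegree with hn
  have h0 : (revPoly f.coeff n).coeff 0 ≠ 0 := by
    have := coeff_revPoly f.coeff (le_refl n)
    rw [Nat.sub_self] at this
    rw [this, hn, hf.coeff_natDegree]
    exact one_ne_zero
  obtain ⟨w, hw⟩ := (hI _ h0).surjective U
  refine ⟨w, fun i => ?_⟩
  set x' : V → M := fun i => ∑ k ∈ Finset.range n,
    krylov f A B (k + 1) i • (I ^ (n - 1 - k)) w with hx'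
  have hA : ∀ i, I (∑ j, A i j • x' j) =
      ∑ k ∈ Finset.range n, (krylov f A B k i - f.coeff k * B i) • (I ^ (n - k)) w := by
    intro i
    simp only [hx', Finset.smul_sum]
    rw [Finset.sum_comm, map_sum]
    refine Finset.sum_congr rfl fun k hk => ?_
    rw [Finset.mem_range] at hk
    have h1 := congrFun (mulVec_krylov_succ f A B k) i
    simp only [Pi.sub_apply, Pi.smul_apply, smul_eq_mul] at h1
    rw [← h1, Matrix.mulVec, dotProduct, Finset.sum_smul, map_sum]
    refine Finset.sum_congr rfl fun j _ => ?_
    rw [smul_smul, map_smul, ← Module.End.mul_apply, ← pow_succ',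
      show n - 1 - k + 1 = n - k by omega]
  have hU : U = w + ∑ k ∈ Finset.range n, f.coeff k • (I ^ (n - k)) w := by
    rw [← hw, aeval_revPoly, Finset.sum_range_succ, hf.coeff_natDegree, add_comm]
    simp
  have hx'eq : ∀ i, x' i = I (∑ j, A i j • x' j) + B i • U := by
    intro i
    have htel := Finset.sum_range_sub (fun k => krylov f A B k i • (I ^ (n - k)) w) n
    rw [krylov_natDegree hf, krylov_zero, hB] at htel
    have hx'i : x' i = ∑ k ∈ Finset.range n, krylov f A B (k + 1) i • (I ^ (n - (k + 1))) w := by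
      simp only [hx', Nat.sub_sub, add_comm 1]
    rw [hA, hU, hx'i]
    simp only [sub_smul, Finset.sum_sub_distrib, smul_add, Finset.smul_sum, smul_smul,
      mul_comm (B i)] at htel ⊢
    simp at htel
    rw [sub_eq_iff_eq_add] at htel
    rw [htel]
    abel
  have hzero : x - x' = 0 := by
    refine eq_zero_of_eq_apply_mulVec (A := A) (fun p hp => (hI p hp).injective) fun i => ?_
    rw [Pi.sub_apply, hx i, hx'eq i]
    simp [smul_sub, Finset.sum_sub_distrib]
  exact congrFun (sub_eq_zero.1 hzero) i

/-- In terms of the flat output `w`, an output `c x` of relative degree `r` is `I ^ (r - 1)` times a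
polynomial in `I` with nonzero constant term. -/
lemma sum_smul_eq_aeval {B c : V → ℂ} {f : ℂ[X]} {r : ℕ} (hr : 1 ≤ r) (hrn : r ≤ f.natDegree)
    (h0 : ∀ k < r - 1, c ⬝ᵥ (A ^ k).mulVec B = 0) {x : V → M} {w : M}
    (hx : ∀ i, x i = ∑ k ∈ Finset.range f.natDegree,
      krylov f A B (k + 1) i • (I ^ (f.natDegree - 1 - k)) w) :
    ∑ i, c i • x i = aeval I (X ^ (r - 1) *
      revPoly (fun k => c ⬝ᵥ krylov f A B (k + 1)) (f.natDegree - r)) w := by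
  have h := revPoly_eq_X_pow_mul (c := fun k => c ⬝ᵥ krylov f A B (k + 1)) (n := f.natDegree - 1)
    (j := r - 1) (by omega) fun k hk hk' =>
      dotProduct_krylov_eq_zero h0 (by omega) hr (by omega)
  rw [show f.natDegree - 1 - (r - 1) = f.natDegree - r by omega] at h
  rw [← h, aeval_revPoly, LinearMap.sum_apply, Nat.sub_add_cancel (by omega)]
  simp only [hx, Finset.smul_sum]
  rw [Finset.sum_comm]
  refine Finset.sum_congr rfl fun k _ => ?_
  simp only [smul_smul, dotProduct]
  rw [← Finset.sum_smul]
  rfl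

end IntegralEquation

end

/-! ### Invariant zeros and the stable quotient of the outputs -/

section

open Polynomial Matrix MeasureTheory

variable {V : Type*} [Fintype V] [DecidableEq V]

/-- The Markov parameters commute with complexification. -/
lemma ofReal_dotProduct_pow_mulVec (A : Matrix V V ℝ) (B c : V → ℝ) (k : ℕ) :
    (fun i => (c i : ℂ)) ⬝ᵥ (A.map Complex.ofReal ^ k).mulVec (fun i => (B i : ℂ)) =
      ((c ⬝ᵥ (A ^ k).mulVec B : ℝ) : ℂ) := by
  have h1 : A.map Complex.ofReal ^ k = (A ^ k).map Complex.ofRealHom :=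
    (map_pow Complex.ofRealHom.mapMatrix A k).symm
  rw [h1]
  simp [dotProduct, Matrix.mulVec]

/-- The roots of the numerator polynomial formed with a monic annihilator of `B` of least degree
are invariant zeros. -/
lemma isInvariantZero_of_sum_eq_zero (S : SISO V) {f : ℂ[X]} (hf : f.Monic)
    (hB : (aeval (S.A.map Complex.ofReal) f).mulVec (fun i => (S.B i : ℂ)) = 0)
    (hmin : ∀ p : ℂ[X], p.Monic →
      (aeval (S.A.map Complex.ofReal) p).mulVec (fun i => (S.B i : ℂ)) = 0 →
      f.natDegree ≤ p.natDegree) (hn : 0 < f.natDegree) {s : ℂ}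
    (hs : ∑ k ∈ Finset.range f.natDegree, ((fun i => (S.C i : ℂ)) ⬝ᵥ
      krylov f (S.A.map Complex.ofReal) (fun i => (S.B i : ℂ)) (k + 1)) * s ^ k = 0) :
    S.IsInvariantZero s := by
  refine ⟨_, f.eval s, sum_krylov_ne_zero hf hn hmin s, ?_, ?_⟩
  · rw [smul_sub_mulVec_sum_krylov hf hB, sub_self]
  · rw [dotProduct_sum, ← hs]
    refine Finset.sum_congr rfl fun k _ => ?_
    rw [dotProduct_smul, smul_eq_mul, mul_comm]

/-- The target output is obtained from the monitor output by a bounded operator: the transfer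
function from monitor to target is proper because `rm ≤ rτ`, and its poles are invariant zeros of
the monitor system. -/
lemma exists_l2Bounded_of_relativeDegree_le {S : SISO V} {Ct : V → ℝ} {rm rτ : ℕ}
    (hrm : S.HasRelativeDegree rm)
    (hrτ : (⟨S.A, S.B, Ct⟩ : SISO V).HasRelativeDegree rτ)
    (hzero : S.NoUnstableInvariantZero) (hle : rm ≤ rτ) :
    ∃ T ∈ l2Bounded, ∀ (x : V → C(ℝ, ℂ)) (U : C(ℝ, ℂ)),
      (∀ i, x i = volterra (∑ j, (S.A i j : ℂ) • x j) + (S.B i : ℂ) • U) →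
      ∑ i, (Ct i : ℂ) • x i = T (∑ i, (S.C i : ℂ) • x i) := by
  obtain ⟨hrm1, -, hm0, hm1⟩ := hrm
  obtain ⟨hrτ1, -, ht0, ht1⟩ := hrτ
  set A' := S.A.map Complex.ofReal with hA'
  set B' : V → ℂ := fun i => (S.B i : ℂ) with hB'
  set cm : V → ℂ := fun i => (S.C i : ℂ) with hcm
  set ct : V → ℂ := fun i => (Ct i : ℂ) with hct
  have hm0' : ∀ k < rm - 1, cm ⬝ᵥ (A' ^ k).mulVec B' = 0 := fun k hk => by
    rw [ofReal_dotProduct_pow_mulVec, hm0 k hk, Complex.ofReal_zero]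
  have hm1' : cm ⬝ᵥ (A' ^ (rm - 1)).mulVec B' ≠ 0 := by
    rw [ofReal_dotProduct_pow_mulVec]
    exact Complex.ofReal_ne_zero.2 hm1
  have ht0' : ∀ k < rτ - 1, ct ⬝ᵥ (A' ^ k).mulVec B' = 0 := fun k hk => by
    have := ht0 k hk
    rw [ofReal_dotProduct_pow_mulVec, this, Complex.ofReal_zero]
  have ht1' : ct ⬝ᵥ (A' ^ (rτ - 1)).mulVec B' ≠ 0 := by
    rw [ofReal_dotProduct_pow_mulVec]
    exact Complex.ofReal_ne_zero.2 ht1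
  obtain ⟨f, hf, hB, hmin⟩ := exists_minimal_annihilator A' B'
  have hrmn := le_natDegree_of_markov_ne_zero hf hB hm0' hrm1 hm1'
  have hrτn := le_natDegree_of_markov_ne_zero hf hB ht0' hrτ1 ht1'
  set n := f.natDegree with hn
  set c : ℕ → ℂ := fun k => cm ⬝ᵥ krylov f A' B' (k + 1) with hc
  set P := revPoly c (n - rm) with hP
  set Q := X ^ (rτ - rm) * revPoly (fun k => ct ⬝ᵥ krylov f A' B' (k + 1)) (n - rτ) with hQ
  have hc0 : ∀ k ∈ Finset.range n, k ∉ Finset.range (n - rm + 1) → c k = 0 := by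
    intro k hk hk'
    rw [Finset.mem_range] at hk hk'
    exact dotProduct_krylov_eq_zero hm0' (by omega) hrm1 hk
  have hzero' : ∀ s : ℂ, 0 ≤ s.re → ∑ k ∈ Finset.range (n - rm + 1), c k * s ^ k ≠ 0 := by
    intro s hs h
    refine hzero s hs (isInvariantZero_of_sum_eq_zero S hf hB hmin (by omega) ?_)
    rw [← h]
    refine (Finset.sum_subset (Finset.range_subset_range.2 (by omega)) fun k hk hk' => ?_).symm
    exact mul_eq_zero_of_left (hc0 k hk hk') _
  have hP0 : P.coeff 0 ≠ 0 := by
    have := coeff_revPoly c (le_refl (n - rm))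
    rw [Nat.sub_self] at this
    rw [this, hc]
    simpa only [hn] using (dotProduct_krylov_natDegree_sub hf hm0' hrm1 hrmn).trans_ne hm1'
  have hroots : ∀ ρ, P.IsRoot ρ → ρ.re < 0 := by
    intro ρ hρ
    have hρ0 : ρ ≠ 0 := by
      rintro rfl
      rw [IsRoot, ← coeff_zero_eq_eval_zero] at hρ
      exact hP0 hρ
    by_contra! hre
    refine hzero' ρ⁻¹ ?_ (sum_inv_pow_eq_zero_of_isRoot hρ0 hρ)
    rw [Complex.inv_re]
    exact div_nonneg hre (Complex.normSq_nonneg ρ)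
  -- `0` is not a zero of the monitor system, so `P` has full degree.
  have hPd : n - rm ≤ P.natDegree := by
    refine le_natDegree_of_ne_zero ?_
    have h1 := coeff_revPoly c (Nat.zero_le (n - rm))
    rw [Nat.sub_zero] at h1
    have h2 := hzero' 0 le_rfl
    rw [Finset.sum_range_succ'] at h2
    rw [h1]
    simpa using h2
  have hQd : Q.natDegree ≤ P.natDegree := by
    refine (natDegree_mul_le.trans (add_le_add (natDegree_X_pow_le _)
      (natDegree_revPoly_le _ _))).trans ?_
    omega
  obtain ⟨T, hT, hPT⟩ := exists_l2Bounded_aeval_mul_eq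
    (by rintro h; rw [h] at hP0; exact hP0 (coeff_zero 0)) hroots hQd
  refine ⟨T, hT, fun x U hx => ?_⟩
  obtain ⟨w, hw⟩ := exists_flat_output (I := volterra) (A := A') (B := B') (f := f)
    (fun p hp => (Module.End.isUnit_iff _).1 (isUnit_aeval_volterra hp)) hf hB hx
  have hym := sum_smul_eq_aeval hrm1 hrmn hm0' hw
  have hyt := sum_smul_eq_aeval hrτ1 hrτn ht0' hw
  refine aeval_volterra_injective hP0 ?_
  have hsplit : P * (X ^ (rτ - 1) * revPoly (fun k => ct ⬝ᵥ krylov f A' B' (k + 1)) (n - rτ)) =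
      Q * (X ^ (rm - 1) * P) := by
    rw [hQ, show rτ - 1 = (rτ - rm) + (rm - 1) by omega, pow_add]
    ring
  have hsplit' := DFunLike.congr_fun (congrArg (aeval volterra) hsplit) w
  rw [map_mul _ P, map_mul _ Q, Module.End.mul_apply, Module.End.mul_apply] at hsplit'
  rw [hyt, hym, hsplit', ← hPT, Module.End.mul_apply]

end

/-! ### The upper bound for trajectories -/

section

open Matrix MeasureTheory Set

lemma energy_eq_iSup (y : ℝ → ℝ) :
    energy y = ⨆ n : ℕ, ∫⁻ t in Ioc (0 : ℝ) n, ENNReal.ofReal (y t ^ 2) := by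
  have h : Ioi (0 : ℝ) = ⋃ n : ℕ, Ioc (0 : ℝ) n := by
    ext t
    simp only [mem_Ioi, mem_iUnion, mem_Ioc]
    exact ⟨fun ht => (exists_nat_ge t).imp fun _ hn => ⟨ht, hn⟩, fun ⟨_, ht, _⟩ => ht⟩
  rw [energy, h]
  refine setLIntegral_iUnion_of_directed _ (Monotone.directed_le fun m n hmn => ?_)
  exact Ioc_subset_Ioc_right (by exact_mod_cast hmn)

lemma setLIntegral_Ioc_eq_ofReal {y : ℝ → ℝ} (hy : ContinuousOn y (Ici 0)) {T : ℝ} (hT : 0 ≤ T) :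
    ∫⁻ t in Ioc (0 : ℝ) T, ENNReal.ofReal (y t ^ 2) =
      ENNReal.ofReal (∫ t in (0 : ℝ)..T, y t ^ 2) := by
  rw [intervalIntegral.integral_of_le hT, ofReal_integral_eq_lintegral_ofReal]
  · refine IntegrableOn.mono_set (t := Icc 0 T) ?_ Ioc_subset_Icc_self
    exact ((hy.mono Icc_subset_Ici_self).pow 2).integrableOn_Icc
  · exact Filter.Eventually.of_forall fun t => sq_nonneg _

lemma energy_le_of_forall_integral_le {y z : ℝ → ℝ} (hy : ContinuousOn y (Ici 0))
    (hz : ContinuousOn z (Ici 0)) {K : ℝ} (hK : 0 ≤ K)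
    (h : ∀ t : ℝ, 0 ≤ t → ∫ s in (0 : ℝ)..t, y s ^ 2 ≤ K * ∫ s in (0 : ℝ)..t, z s ^ 2) :
    energy y ≤ ENNReal.ofReal K * energy z := by
  rw [energy_eq_iSup y]
  refine iSup_le fun n => ?_
  rw [setLIntegral_Ioc_eq_ofReal hy n.cast_nonneg]
  refine (ENNReal.ofReal_le_ofReal (h n n.cast_nonneg)).trans ?_
  rw [ENNReal.ofReal_mul hK, ← setLIntegral_Ioc_eq_ofReal hz n.cast_nonneg]
  gcongr
  exact lintegral_mono_set Ioc_subset_Ioi_self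

variable {V : Type*} [Fintype V]

/-- A real function that is continuous on `[0, ∞)`, extended by its value at `0` to a continuous
complex signal on the whole line. -/
noncomputable def extendSignal (y : ℝ → ℝ) (hy : ContinuousOn y (Ici 0)) : C(ℝ, ℂ) :=
  ⟨fun t => (y (max t 0) : ℂ), Complex.continuous_ofReal.comp
    (hy.comp_continuous (by fun_prop) fun t => le_max_right t 0)⟩

lemma extendSignal_apply {y : ℝ → ℝ} (hy : ContinuousOn y (Ici 0)) (t : ℝ) :
    extendSignal y hy t = (y (max t 0) : ℂ) := rfl

lemma MemL2e.intervalIntegrable_indicator {u : ℝ → ℝ} (hu : MemL2e u) (s t : ℝ) :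
    IntervalIntegrable ((Ioi 0).indicator u) volume s t := by
  have h : ∀ t, IntervalIntegrable ((Ioi 0).indicator u) volume 0 t := by
    intro t
    rcases le_or_gt t 0 with ht | ht
    · rw [intervalIntegrable_iff, uIoc_of_ge ht]
      refine integrableOn_zero.congr_fun (fun s hs => ?_) measurableSet_Ioc
      rw [indicator_of_notMem (by simpa using hs.2)]
    · rw [intervalIntegrable_iff, uIoc_of_le ht.le]
      have h1 : IntegrableOn u (Ioc 0 t) := (hu t ht).integrable (by norm_num)
      exact h1.congr_fun (fun s hs => by rw [indicator_of_mem (mem_Ioi.2 hs.1)]) measurableSet_Ioc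
  exact (h s).symm.trans (h t)

/-- The primitive of an input in `L_{2e}`, as a continuous complex signal. -/
noncomputable def inputPrimitive (u : ℝ → ℝ) (hu : MemL2e u) : C(ℝ, ℂ) :=
  ⟨fun t => ((∫ s in (0 : ℝ)..t, (Ioi 0).indicator u s : ℝ) : ℂ), Complex.continuous_ofReal.comp
    (intervalIntegral.continuous_primitive hu.intervalIntegrable_indicator 0)⟩

lemma IsTrajectory.continuousOn_apply {A : Matrix V V ℝ} {B : V → ℝ} {u : ℝ → ℝ}
    {x : ℝ → V → ℝ} (h : IsTrajectory A B u x) (i : V) : ContinuousOn (fun t => x t i) (Ici 0) :=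
  (continuousOn_pi.1 h.1) i

/-- Trajectories from the zero state solve the integrated state equation over the Volterra
operator. -/
lemma IsTrajectory.extendSignal_eq {A : Matrix V V ℝ} {B : V → ℝ} {u : ℝ → ℝ}
    {x : ℝ → V → ℝ} (h : IsTrajectory A B u x) (h0 : x 0 = 0) (hu : MemL2e u) (i : V) :
    extendSignal _ (h.continuousOn_apply i) =
      volterra (∑ j, (A i j : ℂ) • extendSignal _ (h.continuousOn_apply j)) +
        (B i : ℂ) • inputPrimitive u hu := by
  have hcont : Continuous fun t : ℝ => A.mulVec (x (max t 0)) i := by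
    have hx : ∀ j, Continuous fun t : ℝ => x (max t 0) j := fun j =>
      (h.continuousOn_apply j).comp_continuous (by fun_prop) fun t => le_max_right t 0
    exact continuous_finsetSum _ fun j _ => continuous_const.mul (hx j)
  have hreal : ∀ t : ℝ, x (max t 0) i = (∫ s in (0 : ℝ)..t, A.mulVec (x (max s 0)) i) +
      B i * ∫ s in (0 : ℝ)..t, (Ioi 0).indicator u s := by
    intro t
    rw [← intervalIntegral.integral_const_mul, ← intervalIntegral.integral_add
      (hcont.intervalIntegrable _ _) ((hu.intervalIntegrable_indicator _ _).const_mul _)]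
    rcases le_or_gt t 0 with ht | ht
    · rw [max_eq_right ht, h0, intervalIntegral.integral_of_ge ht,
        setIntegral_eq_zero_of_forall_eq_zero, neg_zero, Pi.zero_apply]
      intro s hs
      rw [max_eq_right hs.2, h0, indicator_of_notMem (by simpa using hs.2)]
      simp
    · rw [max_eq_left ht.le, h.2 t ht.le i, h0, Pi.zero_apply, zero_add,
        intervalIntegral.integral_of_le ht.le, intervalIntegral.integral_of_le ht.le]
      refine setIntegral_congr_fun measurableSet_Ioc fun s hs => ?_
      rw [mem_Ioc] at hs
      simp only [max_eq_left hs.1.le, indicator_of_mem (mem_Ioi.2 hs.1)]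
  ext t
  rw [extendSignal_apply, hreal t, ContinuousMap.add_apply, volterra_apply]
  push_cast
  congr 1
  rw [← intervalIntegral.integral_ofReal]
  congr 1
  ext s
  simp [Matrix.mulVec, dotProduct, extendSignal_apply]

lemma sum_smul_extendSignal_apply {A : Matrix V V ℝ} {B : V → ℝ} {u : ℝ → ℝ}
    {x : ℝ → V → ℝ} (h : IsTrajectory A B u x) (c : V → ℝ) {t : ℝ} (ht : 0 ≤ t) :
    ‖(∑ i, (c i : ℂ) • extendSignal _ (h.continuousOn_apply i)) t‖ ^ 2 = (c ⬝ᵥ x t) ^ 2 := by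
  have : (∑ i, (c i : ℂ) • extendSignal _ (h.continuousOn_apply i)) t = ((c ⬝ᵥ x t : ℝ) : ℂ) := by
    simp [dotProduct, extendSignal_apply, max_eq_left ht]
  rw [this, Complex.norm_real, Real.norm_eq_abs, sq_abs]

lemma IsTrajectory.continuousOn_dotProduct {A : Matrix V V ℝ} {B : V → ℝ} {u : ℝ → ℝ}
    {x : ℝ → V → ℝ} (h : IsTrajectory A B u x) (c : V → ℝ) :
    ContinuousOn (fun t => c ⬝ᵥ x t) (Ici 0) := by
  simp only [dotProduct]
  exact continuousOn_finsetSum _ fun i _ => continuousOn_const.mul (h.continuousOn_apply i)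

theorem outputToOutputGain_lt_top [DecidableEq V] {S : SISO V} {Ct : V → ℝ} {rm rτ : ℕ}
    (hrm : S.HasRelativeDegree rm)
    (hrτ : (⟨S.A, S.B, Ct⟩ : SISO V).HasRelativeDegree rτ)
    (hzero : S.NoUnstableInvariantZero) (hle : rm ≤ rτ) :
    outputToOutputGain S.A S.B Ct S.C < ⊤ := by
  obtain ⟨T, ⟨K, hK, hT⟩, hTx⟩ := exists_l2Bounded_of_relativeDegree_le hrm hrτ hzero hle
  refine lt_of_le_of_lt (sInf_le ⟨K + 1, by positivity, rfl, fun u x hu hx h0 => ?_⟩)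
    ENNReal.ofReal_lt_top
  refine (energy_le_of_forall_integral_le (hx.continuousOn_dotProduct Ct)
    (hx.continuousOn_dotProduct S.C) hK fun t ht => ?_).trans
    (mul_le_mul_left (ENNReal.ofReal_le_ofReal (by linarith)) _)
  have h1 := hT (∑ i, (S.C i : ℂ) • extendSignal _ (hx.continuousOn_apply i)) t ht
  rw [← hTx _ _ (hx.extendSignal_eq h0 hu)] at h1
  have hcongr : ∀ c : V → ℝ, ∫ s in (0 : ℝ)..t,
      ‖(∑ i, (c i : ℂ) • extendSignal _ (hx.continuousOn_apply i)) s‖ ^ 2 =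
      ∫ s in (0 : ℝ)..t, (c ⬝ᵥ x s) ^ 2 := fun c => by
    refine intervalIntegral.integral_congr fun s hs => ?_
    rw [uIcc_of_le ht] at hs
    exact sum_smul_extendSignal_apply hx c hs.1
  rwa [hcongr, hcongr] at h1

theorem worstCaseImpact_le_outputToOutputGain (A : Matrix V V ℝ) (B Ct Cm : V → ℝ) :
    worstCaseImpact A B Ct Cm ≤ outputToOutputGain A B Ct Cm := by
  refine sSup_le ?_
  rintro _ ⟨u, x, hu, hx, h0, hm, rfl⟩
  refine le_sInf ?_
  rintro _ ⟨γ, -, rfl, hγ⟩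
  exact (hγ u x hu hx h0).trans (mul_le_of_le_one_right' hm)

end

/-! ### The lower bound by compressed bumps -/

section

open Polynomial Matrix MeasureTheory Set

/-- The derivatives of a smooth bump supported in the open half-line. -/
lemma exists_bump_derivatives : ∃ ψ : ℕ → ℝ → ℝ,
    (∀ k t, HasDerivAt (ψ k) (ψ (k + 1) t) t) ∧ (∀ k, HasCompactSupport (ψ k)) ∧
    (∀ k t, t ≤ 0 → ψ k t = 0) ∧ ∀ k, 0 < ∫ t in Ioi (0 : ℝ), ψ k t * ψ k t := by
  let b : ContDiffBump (2 : ℝ) := ⟨1 / 2, 1, by norm_num, by norm_num⟩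
  have hderiv : ∀ k t, HasDerivAt (iteratedDeriv k b) (iteratedDeriv (k + 1) b t) t := fun k t => by
    rw [iteratedDeriv_succ]
    exact ((b.contDiff (n := ((k + 1 : ℕ) : ℕ∞))).differentiable_iteratedDeriv k
      (by exact_mod_cast k.lt_succ_self) t).hasDerivAt
  have hsupp : ∀ k, tsupport (iteratedDeriv k b) ⊆ Metric.closedBall 2 1 := by
    intro k
    induction k with
    | zero => rw [iteratedDeriv_zero, b.tsupport_eq]
    | succ k ih => rw [iteratedDeriv_succ]; exact tsupport_deriv_subset.trans ih
  have hcomp : ∀ k, HasCompactSupport (iteratedDeriv k b) := fun k =>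
    HasCompactSupport.intro' (isCompact_closedBall (2 : ℝ) 1) Metric.isClosed_closedBall
      fun t ht => image_eq_zero_of_notMem_tsupport fun h => ht (hsupp k h)
  have hneg : ∀ k t, t ≤ 0 → iteratedDeriv k b t = 0 := fun k t ht => by
    refine image_eq_zero_of_notMem_tsupport fun h => ?_
    have := hsupp k h
    rw [Metric.mem_closedBall, Real.dist_eq, abs_le] at this
    linarith [this.1]
  have hne : ∀ k, ∃ t, iteratedDeriv k b t ≠ 0 := by
    intro k
    induction k with
    | zero =>
      refine ⟨2, ?_⟩
      rw [iteratedDeriv_zero, b.one_of_mem_closedBall (Metric.mem_closedBall_self (by norm_num))]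
      exact one_ne_zero
    | succ k ih =>
      by_contra! h
      obtain ⟨t, ht⟩ := ih
      refine ht ?_
      rw [is_const_of_deriv_eq_zero (fun t => (hderiv k t).differentiableAt)
        (fun t => (hderiv k t).deriv.trans (h t)) t 0, hneg k 0 le_rfl]
  refine ⟨fun k => iteratedDeriv k b, hderiv, hcomp, hneg, fun k => ?_⟩
  have hc : Continuous (iteratedDeriv k b) :=
    continuous_iff_continuousAt.2 fun t => (hderiv k t).continuousAt
  rw [setIntegral_eq_integral_of_forall_compl_eq_zero
    (fun t ht => mul_eq_zero_of_left (hneg k t (by simpa using ht)) _)]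
  obtain ⟨t, ht⟩ := hne k
  exact (hc.mul hc).integral_pos_of_hasCompactSupport_nonneg_nonzero ((hcomp k).mul_right)
    (fun t => mul_self_nonneg _) (mul_self_ne_zero.2 ht)

variable {V : Type*} [Fintype V] [DecidableEq V]

lemma memL2e_of_continuous {u : ℝ → ℝ} (hu : Continuous u) : MemL2e u := fun T _ => by
  rw [memLp_two_iff_integrable_sq hu.aestronglyMeasurable]
  exact ((hu.pow 2).continuousOn.integrableOn_Icc (a := 0) (b := T)).mono_set Ioc_subset_Icc_self

lemma dotProduct_sum_krylov {A : Matrix V V ℝ} {B c : V → ℝ} {f : ℝ[X]} {r : ℕ} (hr : 1 ≤ r)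
    (hrn : r ≤ f.natDegree) (h0 : ∀ k < r - 1, c ⬝ᵥ (A ^ k).mulVec B = 0) (q : ℕ → ℝ) :
    c ⬝ᵥ ∑ k ∈ Finset.range f.natDegree, q k • krylov f A B (k + 1) =
      ∑ k ∈ Finset.range (f.natDegree - r + 1), (c ⬝ᵥ krylov f A B (k + 1)) * q k := by
  simp only [dotProduct_sum, dotProduct_smul, smul_eq_mul]
  rw [Finset.sum_congr rfl fun k _ => mul_comm (q k) _]
  refine (Finset.sum_subset (Finset.range_subset_range.2 (by omega)) fun k hk hk' => ?_).symm
  rw [Finset.mem_range] at hk hk'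
  rw [dotProduct_krylov_eq_zero h0 (by omega) hr hk, zero_mul]

/-- Every smooth flat output `p 0` with derivatives `p k` that vanish at `0` generates a
trajectory from the zero state. -/
lemma isTrajectory_of_hasDerivAt {A : Matrix V V ℝ} {B : V → ℝ} {f : ℝ[X]} (hf : f.Monic)
    (hB : (aeval A f).mulVec B = 0) {p : ℕ → ℝ → ℝ}
    (hp : ∀ k t, HasDerivAt (p k) (p (k + 1) t) t) :
    IsTrajectory A B (fun t => ∑ k ∈ Finset.range (f.natDegree + 1), f.coeff k * p k t)
      (fun t => ∑ k ∈ Finset.range f.natDegree, p k t • krylov f A B (k + 1)) := by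
  have hpc : ∀ k, Continuous (p k) := fun k =>
    continuous_iff_continuousAt.2 fun t => (hp k t).continuousAt
  have hxc : Continuous fun t => ∑ k ∈ Finset.range f.natDegree, p k t • krylov f A B (k + 1) :=
    continuous_finsetSum _ fun k _ => (hpc k).smul continuous_const
  have huc : Continuous fun t => ∑ k ∈ Finset.range (f.natDegree + 1), f.coeff k * p k t :=
    continuous_finsetSum _ fun k _ => continuous_const.mul (hpc k)
  refine ⟨hxc.continuousOn, fun t _ i => ?_⟩
  have hd : ∀ t, HasDerivAt
      (fun t => (∑ k ∈ Finset.range f.natDegree, p k t • krylov f A B (k + 1)) i)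
      (A.mulVec (∑ k ∈ Finset.range f.natDegree, p k t • krylov f A B (k + 1)) i +
        B i * ∑ k ∈ Finset.range (f.natDegree + 1), f.coeff k * p k t) t := by
    intro t
    have h1 : HasDerivAt
        (fun t => (∑ k ∈ Finset.range f.natDegree, p k t • krylov f A B (k + 1)) i)
        (∑ k ∈ Finset.range f.natDegree, p (k + 1) t * krylov f A B (k + 1) i) t := by
      simp only [Finset.sum_apply, Pi.smul_apply, smul_eq_mul]
      exact HasDerivAt.fun_sum fun k _ => (hp k t).mul_const _
    convert h1 using 1
    have htel := Finset.sum_range_sub (fun k => p k t * krylov f A B k i) f.natDegree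
    rw [krylov_natDegree hf, krylov_zero, hB] at htel
    rw [Matrix.mulVec_sum, Finset.sum_apply, Finset.sum_range_succ, hf.coeff_natDegree]
    simp only [Matrix.mulVec_smul, mulVec_krylov_succ, Pi.smul_apply, Pi.sub_apply, smul_eq_mul,
      mul_sub, Finset.sum_sub_distrib, Pi.zero_apply, mul_zero, sub_zero, mul_add, one_mul,
      Finset.mul_sum] at htel ⊢
    have hcomm : ∀ k, p k t * (f.coeff k * B i) = B i * (f.coeff k * p k t) := fun k => by ring
    simp only [hcomm]
    linarith
  have hA : Continuous fun t =>
      A.mulVec (∑ k ∈ Finset.range f.natDegree, p k t • krylov f A B (k + 1)) i :=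
    (continuous_apply i).comp (Continuous.matrix_mulVec continuous_const hxc)
  rw [intervalIntegral.integral_eq_sub_of_hasDerivAt (fun s _ => hd s)
    ((hA.add (continuous_const.mul huc)).intervalIntegrable _ _)]
  ring

/-- The polynomial `∑ k, l ≤ d, c k c l ⟨ψ k, ψ l⟩ ν ^ (k + l)` in the time scale `ν`, which up to a
factor is the energy of the output `∑ k ≤ d, c k ν ^ k ψ k (ν t)`. -/
noncomputable def energyPoly (ψ : ℕ → ℝ → ℝ) (c : ℕ → ℝ) (d : ℕ) : ℝ[X] :=
  ∑ k ∈ Finset.range (d + 1), ∑ l ∈ Finset.range (d + 1),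
    C (c k * c l * ∫ t in Ioi (0 : ℝ), ψ k t * ψ l t) * X ^ (k + l)

lemma degree_energyPoly {ψ : ℕ → ℝ → ℝ} (hψ : ∀ k, 0 < ∫ t in Ioi (0 : ℝ), ψ k t * ψ k t)
    {c : ℕ → ℝ} {d : ℕ} (hc : c d ≠ 0) : (energyPoly ψ c d).degree = (2 * d : ℕ) := by
  refine degree_eq_of_le_of_coeff_ne_zero ?_ ?_
  · refine (degree_sum_le _ _).trans (Finset.sup_le fun k hk => ?_)
    refine (degree_sum_le _ _).trans (Finset.sup_le fun l hl => ?_)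
    rw [Finset.mem_range] at hk hl
    refine (degree_C_mul_X_pow_le _ _).trans ?_
    exact_mod_cast (by omega : k + l ≤ 2 * d)
  · have : (energyPoly ψ c d).coeff (2 * d) = c d * c d * ∫ t in Ioi (0 : ℝ), ψ d t * ψ d t := by
      rw [energyPoly, finsetSum_coeff, Finset.sum_eq_single_of_mem d (Finset.self_mem_range_succ d),
        finsetSum_coeff, Finset.sum_eq_single_of_mem d (Finset.self_mem_range_succ d)]
      · rw [coeff_C_mul, coeff_X_pow, if_pos (two_mul d), mul_one]
      · intro l hl hld
        rw [Finset.mem_range] at hl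
        rw [coeff_C_mul, coeff_X_pow, if_neg (by omega), mul_zero]
      · intro k hk hkd
        rw [finsetSum_coeff]
        refine Finset.sum_eq_zero fun l hl => ?_
        rw [Finset.mem_range] at hk hl
        rw [coeff_C_mul, coeff_X_pow, if_neg (by omega), mul_zero]
    rw [this]
    exact mul_ne_zero (mul_self_ne_zero.2 hc) (hψ d).ne'

lemma eval_energyPoly {ψ : ℕ → ℝ → ℝ} (hψ : ∀ k, Continuous (ψ k))
    (hψ' : ∀ k, HasCompactSupport (ψ k)) (c : ℕ → ℝ) (d : ℕ) (ν : ℝ) :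
    (energyPoly ψ c d).eval ν =
      ∫ t in Ioi (0 : ℝ), (∑ k ∈ Finset.range (d + 1), c k * (ν ^ k * ψ k t)) ^ 2 := by
  have hi : ∀ k l, Integrable (fun t => ψ k t * ψ l t) (volume.restrict (Ioi 0)) := fun k l =>
    (((hψ k).mul (hψ l)).integrable_of_hasCompactSupport ((hψ' k).mul_right)).restrict
  have hexp : ∀ t, (∑ k ∈ Finset.range (d + 1), c k * (ν ^ k * ψ k t)) ^ 2 =
      ∑ k ∈ Finset.range (d + 1), ∑ l ∈ Finset.range (d + 1),
        c k * c l * ν ^ (k + l) * (ψ k t * ψ l t) := fun t => by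
    rw [sq, Finset.sum_mul_sum]
    refine Finset.sum_congr rfl fun k _ => Finset.sum_congr rfl fun l _ => ?_
    ring
  simp only [hexp]
  rw [integral_finsetSum _ fun k _ => integrable_finsetSum _ fun l _ => (hi k l).const_mul _,
    energyPoly, eval_finsetSum]
  refine Finset.sum_congr rfl fun k _ => ?_
  rw [integral_finsetSum _ fun l _ => (hi k l).const_mul _, eval_finsetSum]
  refine Finset.sum_congr rfl fun l _ => ?_
  rw [integral_const_mul, eval_mul, eval_C, eval_pow, eval_X]
  ring

lemma energy_eq_ofReal {ψ : ℕ → ℝ → ℝ} (hψ : ∀ k, Continuous (ψ k))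
    (hψ' : ∀ k, HasCompactSupport (ψ k)) (c : ℕ → ℝ) (d : ℕ) (σ : ℝ) {ν : ℝ} (hν : 0 < ν) :
    energy (fun t => ∑ k ∈ Finset.range (d + 1), c k * (σ * ν ^ k * ψ k (ν * t))) =
      ENNReal.ofReal (σ ^ 2 * ν⁻¹ * (energyPoly ψ c d).eval ν) := by
  set g : ℝ → ℝ := fun t => ∑ k ∈ Finset.range (d + 1), c k * (ν ^ k * ψ k t) with hg
  have hgc : Continuous g :=
    continuous_finsetSum _ fun k _ => continuous_const.mul (continuous_const.mul (hψ k))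
  have hgs : HasCompactSupport g := by
    have : g = ∑ k ∈ Finset.range (d + 1), fun t => c k * (ν ^ k * ψ k t) := by
      ext t; simp [hg]
    rw [this]
    refine Finset.sum_induction _ HasCompactSupport (fun _ _ h1 h2 => h1.add h2)
      HasCompactSupport.zero fun k _ => ?_
    exact ((hψ' k).mul_left (f := fun _ => ν ^ k)).mul_left (f := fun _ => c k)
  have hgi : Integrable fun t => g t ^ 2 := by
    simp only [sq]
    exact (hgc.mul hgc).integrable_of_hasCompactSupport hgs.mul_right
  have hfun : (fun t => ∑ k ∈ Finset.range (d + 1), c k * (σ * ν ^ k * ψ k (ν * t))) =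
      fun t => σ * g (ν * t) := by
    ext t
    rw [hg, Finset.mul_sum]
    exact Finset.sum_congr rfl fun k _ => by ring
  rw [hfun, energy, ← ofReal_integral_eq_lintegral_ofReal]
  · simp only [mul_pow]
    rw [integral_const_mul, integral_comp_mul_left_Ioi (fun t => g t ^ 2) 0 hν, mul_zero,
      eval_energyPoly hψ hψ', smul_eq_mul, mul_assoc]
  · simp only [mul_pow]
    exact ((hgi.comp_mul_left' hν.ne').const_mul _).restrict
  · exact Filter.Eventually.of_forall fun t => sq_nonneg _

/-- If the monitor has the larger relative degree, then the flat output `ψ (ν t)` gives a target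
energy of order `ν ^ (2 (n - rτ))` and a monitor energy of order `ν ^ (2 (n - rm))`, up to a common
factor, and their ratio is unbounded as `ν → ∞`. -/
theorem worstCaseImpact_eq_top {A : Matrix V V ℝ} {B Ct Cm : V → ℝ} {rm rτ : ℕ}
    (hrm : (⟨A, B, Cm⟩ : SISO V).HasRelativeDegree rm)
    (hrτ : (⟨A, B, Ct⟩ : SISO V).HasRelativeDegree rτ) (hlt : rτ < rm) :
    worstCaseImpact A B Ct Cm = ⊤ := by
  obtain ⟨hrm1, hrmn, hm0, hm1⟩ := hrm
  obtain ⟨hrτ1, hrτn, ht0, ht1⟩ := hrτ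
  obtain ⟨ψ, hψd, hψs, hψ0, hψpos⟩ := exists_bump_derivatives
  have hψc : ∀ k, Continuous (ψ k) := fun k =>
    continuous_iff_continuousAt.2 fun t => (hψd k t).continuousAt
  set f := A.charpoly with hf
  have hfm : f.Monic := A.charpoly_monic
  have hB : (aeval A f).mulVec B = 0 := by rw [Matrix.aeval_self_charpoly, Matrix.zero_mulVec]
  rw [← A.charpoly_natDegree_eq_dim, ← hf] at hrmn hrτn
  have hcm := (dotProduct_krylov_natDegree_sub hfm hm0 hrm1 hrmn).trans_ne hm1
  have hct := (dotProduct_krylov_natDegree_sub hfm ht0 hrτ1 hrτn).trans_ne ht1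
  set Em := energyPoly ψ (fun k => Cm ⬝ᵥ krylov f A B (k + 1)) (f.natDegree - rm) with hEm
  set Et := energyPoly ψ (fun k => Ct ⬝ᵥ krylov f A B (k + 1)) (f.natDegree - rτ) with hEt
  have hEm0 : Em ≠ 0 := by
    intro h
    have := degree_energyPoly hψpos (c := fun k => Cm ⬝ᵥ krylov f A B (k + 1)) hcm
    rw [← hEm, h, degree_zero] at this
    exact WithBot.bot_ne_coe this
  have hdeg : Em.degree < Et.degree := by
    rw [hEm, hEt, degree_energyPoly hψpos hcm, degree_energyPoly hψpos hct]
    exact_mod_cast (by omega : 2 * (f.natDegree - rm) < 2 * (f.natDegree - rτ))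
  have hratio := abs_div_tendsto_atTop_atTop_of_degree_gt Et Em hdeg hEm0
  refine ENNReal.eq_top_of_forall_nnreal_le fun K => le_of_lt ?_
  obtain ⟨ν, hν, hν0⟩ := ((hratio.eventually_gt_atTop (K : ℝ)).and
    (Filter.eventually_gt_atTop 0)).exists
  have hm_nonneg : 0 ≤ Em.eval ν := by
    rw [hEm, eval_energyPoly hψc hψs]
    exact integral_nonneg fun _ => sq_nonneg _
  have ht_nonneg : 0 ≤ Et.eval ν := by
    rw [hEt, eval_energyPoly hψc hψs]
    exact integral_nonneg fun _ => sq_nonneg _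
  rw [abs_of_nonneg (div_nonneg ht_nonneg hm_nonneg)] at hν
  -- The quotient is positive, so its denominator is not zero.
  have hm_pos : 0 < Em.eval ν := by
    refine hm_nonneg.lt_of_ne fun h => ?_
    rw [← h, div_zero] at hν
    exact absurd hν (not_lt.2 K.coe_nonneg)
  -- The amplitude for which the monitor energy is exactly `1`.
  set σ := Real.sqrt (ν / Em.eval ν) with hσ
  have hσ2 : σ ^ 2 = ν / Em.eval ν := Real.sq_sqrt (div_nonneg hν0.le hm_nonneg)
  set p : ℕ → ℝ → ℝ := fun k t => σ * ν ^ k * ψ k (ν * t) with hp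
  have hpd : ∀ k t, HasDerivAt (p k) (p (k + 1) t) t := fun k t => by
    have h := ((hψd k (ν * t)).comp t ((hasDerivAt_id t).const_mul ν)).const_mul (σ * ν ^ k)
    convert! h using 1
    simp only [hp]
    ring
  have hpc : ∀ k, Continuous (p k) := fun k =>
    continuous_iff_continuousAt.2 fun t => (hpd k t).continuousAt
  refine lt_of_lt_of_le ?_ (le_sSup ⟨_, _, memL2e_of_continuous (continuous_finsetSum _ fun k _ =>
    continuous_const.mul (hpc k)), isTrajectory_of_hasDerivAt hfm hB hpd, ?_, ?_, rfl⟩)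
  · simp only [dotProduct_sum_krylov hrτ1 hrτn ht0]
    rw [energy_eq_ofReal hψc hψs _ _ _ hν0, ← hEt, hσ2, ENNReal.lt_ofReal_iff_toReal_lt
      ENNReal.coe_ne_top, ENNReal.coe_toReal]
    refine hν.trans_eq ?_
    field_simp
  · exact Finset.sum_eq_zero fun k _ => by simp [hp, hψ0 k 0 le_rfl]
  · simp only [dotProduct_sum_krylov hrm1 hrmn hm0]
    rw [energy_eq_ofReal hψc hψs _ _ _ hν0, ← hEm, hσ2, ENNReal.ofReal_le_one]
    refine le_of_eq ?_
    field_simp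

end

end NetAttack

theorem theorem1 {V : Type*} [Fintype V] [DecidableEq V]
    (G : SimpleGraph V) (hG : G.Connected)
    (W : Matrix V V ℝ) (hW : NetAttack.IsWeightedAdjacency G W)
    (L : Matrix V V ℝ) (hL : L = NetAttack.laplacian W)
    (a τ m : V)
    (St Sm : NetAttack.SISO V)
    (hSt : St = NetAttack.vertexSystem L a τ)
    (hSm : Sm = NetAttack.vertexSystem L a m)
    (rτ rm : ℕ)
    (hrτ : St.HasRelativeDegree rτ)
    (hrm : Sm.HasRelativeDegree rm)
    (hzero : Sm.NoUnstableInvariantZero) :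
    (NetAttack.worstCaseImpact (-L) (Pi.single a 1) St.C Sm.C < ⊤ ↔ rm ≤ rτ) ∧
    (NetAttack.outputToOutputGain (-L) (Pi.single a 1) St.C Sm.C < ⊤ ↔ rm ≤ rτ) := by
  subst hSt hSm
  let S : V → NetAttack.SISO V := fun v => ⟨-L, Pi.single a 1, Pi.single v 1⟩
  change (S τ).HasRelativeDegree rτ at hrτ
  change (S m).HasRelativeDegree rm at hrm
  change (S m).NoUnstableInvariantZero at hzero
  change (NetAttack.worstCaseImpact (S m).A (S m).B (S τ).C (S m).C < ⊤ ↔ rm ≤ rτ) ∧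
    (NetAttack.outputToOutputGain (S m).A (S m).B (S τ).C (S m).C < ⊤ ↔ rm ≤ rτ)
  have hgain := NetAttack.outputToOutputGain_lt_top (S := S m) (Ct := (S τ).C) hrm hrτ hzero
  have himpact := NetAttack.worstCaseImpact_le_outputToOutputGain
    (S m).A (S m).B (S τ).C (S m).C
  have hle : NetAttack.worstCaseImpact (S m).A (S m).B (S τ).C (S m).C < ⊤ → rm ≤ rτ := by
    intro h
    by_contra! hlt
    exact h.ne (NetAttack.worstCaseImpact_eq_top (A := (S m).A) (B := (S m).B) hrm hrτ hlt)
  exact ⟨⟨hle, fun h => himpact.trans_lt (hgain h)⟩, ⟨fun h => hle (himpact.trans_lt h), hgain⟩⟩
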